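/- Theorem (Collins and Śniady). Let $n, d \ge 0$ be integers (no assumption $d \ge n$ is made), and let $dU$ be the Haar probability measure on the group $U(d)$ of unitary $d\times d$ complex matrices $U = (u_{kl})$. For all multi-indices $\mathbf i, \mathbf j, \mathbf i', \mathbf j' \in \{1,\dots,d\}^n$, $$\int_{U(d)} u_{i_1 j_1}\cdots u_{i_n j_n}\, \overline{u_{i'_1 j'_1}}\cdots \overline{u_{i'_n j'_n}}\; dU \;=\; \sum_{\sigma,\tau\in S_n} \delta_{\sigma(\mathbf i),\mathbf i'}\,\delta_{\tau(\mathbf j),\mathbf j'}\,\mathrm{Wg}(\tau\sigma^{-1}).$$ Here $S_n$ acts on multi-indices by permuting places, $\sigma(\mathbf i)_k = i_{\sigma^{-1}(k)}$, and $\delta_{\mathbf a,\mathbf b}$ is $1$ if $\mathbf a=\mathbf b$ and $0$ otherwise. The Weingarten function $\mathrm{Wg}\colon S_n\to\mathbb C$ is $$\mathrm{Wg}(\sigma) = \frac{1}{(n!)^2}\sum_{\lambda\vdash n,\ \ell(\lambda)\le d} \frac{(\dim S^\lambda)^2}{\dim W^\lambda}\,\chi^{\lambda}(\sigma),$$ where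 $\ell(\lambda)$ is the number of parts of the partition $\lambda$. To define $S^\lambda$ and $W^\lambda$, fix a bijective filling of the Young diagram of $\lambda$ by $1,\dots,n$, with row stabilizer $R$ and column stabilizer $C$, and let $c_\lambda = \bigl(\sum_{p\in R} p\bigr)\bigl(\sum_{q\in C}\operatorname{sgn}(q)\, q\bigr)\in\mathbb C[S_n]$ be the Young symmetrizer. Then $S^\lambda=\mathbb C[S_n]c_\lambda$ is the Specht module, an irreducible representation of $S_n$ by left multiplication, with character $\chi^\lambda$; and $W^\lambda = c_\lambda\cdot(\mathbb C^d)^{\otimes n}$ is the corresponding Weyl module of $U(d)$, where $S_n$ acts on $(\mathbb C^d)^{\otimes n}$ by permuting the tensor factors. (Up to isomorphism, $S^\lambda$ and $W^\lambda$ do not depend on the filling.) -/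

import Mathlib

open MeasureTheory
open scoped TensorProduct Nat MonoidAlgebra

namespace Weingarten

noncomputable section

/-! ### The unitary group and its Haar measure -/

/-- The group `U(d)` of unitary `d × d` complex matrices. -/
abbrev U (d : ℕ) : Type := Matrix.unitaryGroup (Fin d) ℂ

instance (d : ℕ) : CompactSpace (U d) := by
  have hcl : IsClosed {A : Matrix (Fin d) (Fin d) ℂ | star A * A = 1 ∧ A * star A = 1} :=
    (isClosed_eq (continuous_star.mul continuous_id) continuous_const).inter
      (isClosed_eq (continuous_id.mul continuous_star) continuous_const)
  have hK : IsCompact (Set.univ.pi fun _ : Fin d => Set.univ.pi fun _ : Fin d =>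
      Metric.closedBall (0 : ℂ) 1) :=
    isCompact_univ_pi fun _ => isCompact_univ_pi fun _ => isCompact_closedBall _ _
  refine isCompact_iff_compactSpace.mp (IsCompact.of_isClosed_subset hK hcl ?_)
  intro A hA i _ j _
  rw [mem_closedBall_zero_iff]
  exact entry_norm_bound_of_unitary (𝕜 := ℂ) (U := A) hA i j

/-- `U(d)` carries its Borel `σ`-algebra. -/
instance (d : ℕ) : MeasurableSpace (U d) := borel _

instance (d : ℕ) : BorelSpace (U d) := ⟨rfl⟩

/-- The normalized Haar measure on `U(d)`, of total mass one. -/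
def haar (d : ℕ) : Measure (U d) := Measure.haarMeasure ⊤

/-! ### Young diagrams, Young symmetrizers and Specht modules -/

/-- The Young diagram of a partition: its row lengths are the parts in decreasing order. -/
def diagram {n : ℕ} (p : n.Partition) : YoungDiagram :=
  YoungDiagram.ofRowLens (p.parts.sort (· ≥ ·))
    ((p.parts.pairwise_sort (· ≥ ·)).sortedGE)

theorem card_cellsOfRowLens (w : List ℕ) :
    (YoungDiagram.cellsOfRowLens w).card = w.sum := by
  induction w with
  | nil => simp [YoungDiagram.cellsOfRowLens]
  | cons a w ih =>
    rw [YoungDiagram.cellsOfRowLens, Finset.card_union_of_disjoint]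
    · simp [ih]
    · rw [Finset.disjoint_left]
      rintro ⟨x, y⟩ h1 h2
      simp only [Finset.mem_product, Finset.mem_singleton, Finset.mem_map] at h1 h2
      obtain ⟨⟨u, v⟩, -, h⟩ := h2
      simp only [Function.Embedding.prodMap, Function.Embedding.coeFn_mk, Prod.map,
        Prod.mk.injEq] at h
      omega

theorem card_diagram {n : ℕ} (p : n.Partition) : (diagram p).cells.card = n := by
  have h : (p.parts.sort (· ≥ ·)).sum = n := by
    rw [← Multiset.sum_coe, Multiset.sort_eq, p.parts_sum]
  exact (card_cellsOfRowLens _).trans h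

/-- A Young tableau of shape `p`: a bijective filling of the boxes of the diagram, given by the
box `tableau p k` that contains `k`. The filling is an arbitrary one; another choice conjugates the
Young symmetrizer by a permutation and gives isomorphic Specht and Weyl modules. -/
def tableau {n : ℕ} (p : n.Partition) : Fin n ≃ (diagram p).cells :=
  ((diagram p).cells.equivFinOfCardEq (card_diagram p)).symm

/-- The row in which `k` stands. -/
def rowOf {n : ℕ} (p : n.Partition) (k : Fin n) : ℕ := (tableau p k).1.1

/-- The column in which `k` stands. -/
def colOf {n : ℕ} (p : n.Partition) (k : Fin n) : ℕ := (tableau p k).1.2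

/-- The group algebra `ℂ[S_n]`. -/
abbrev GroupAlg (n : ℕ) : Type := MonoidAlgebra ℂ (Equiv.Perm (Fin n))

/-- The Young symmetrizer of shape `p`: the sum over the row stabilizer, times the signed sum over
the column stabilizer, of the tableau. -/
def youngSymmetrizer {n : ℕ} (p : n.Partition) : GroupAlg n :=
  (∑ σ : Equiv.Perm (Fin n) with ∀ k, rowOf p (σ k) = rowOf p k,
      MonoidAlgebra.of ℂ (Equiv.Perm (Fin n)) σ) *
  (∑ σ : Equiv.Perm (Fin n) with ∀ k, colOf p (σ k) = colOf p k,
      ((Equiv.Perm.sign σ : ℤ) : ℂ) • MonoidAlgebra.of ℂ (Equiv.Perm (Fin n)) σ)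

/-- The Specht module `S^p`: the left ideal of `ℂ[S_n]` generated by the Young symmetrizer. -/
abbrev specht {n : ℕ} (p : n.Partition) : Submodule (GroupAlg n) (GroupAlg n) :=
  Submodule.span (GroupAlg n) {youngSymmetrizer p}

/-- The irreducible representation of `S_n` on the Specht module, by left multiplication. -/
def spechtRep {n : ℕ} (p : n.Partition) :
    Representation ℂ (Equiv.Perm (Fin n)) (specht p) :=
  Representation.ofModule' (specht p)

/-- The character of the Specht module. -/
def spechtChar {n : ℕ} (p : n.Partition) (σ : Equiv.Perm (Fin n)) : ℂ :=
  (spechtRep p).character σ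

/-! ### Tensor powers and Weyl modules -/

/-- The tensor power `(ℂ^d)^{⊗ n}`. -/
abbrev TensorPow (n d : ℕ) : Type := ⨂[ℂ] _ : Fin n, (Fin d → ℂ)

/-- The representation of `S_n` on `(ℂ^d)^{⊗ n}` permuting the tensor factors, so that `σ` sends
`v_1 ⊗ ⋯ ⊗ v_n` to the tensor whose `k`-th factor is `v_{σ⁻¹(k)}`. -/
def permRep (n d : ℕ) : Representation ℂ (Equiv.Perm (Fin n)) (TensorPow n d) where
  toFun σ := (PiTensorProduct.reindex ℂ (fun _ : Fin n => (Fin d → ℂ)) σ).toLinearMap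
  map_one' := by
    refine PiTensorProduct.ext (MultilinearMap.ext fun v => ?_)
    simp only [LinearMap.compMultilinearMap_apply, LinearEquiv.coe_coe,
      PiTensorProduct.reindex_tprod]
    rfl
  map_mul' σ τ := by
    refine PiTensorProduct.ext (MultilinearMap.ext fun v => ?_)
    simp only [LinearMap.compMultilinearMap_apply, LinearEquiv.coe_coe, Module.End.mul_apply,
      PiTensorProduct.reindex_tprod]
    rfl

/-- The Weyl module `W^p` of `U(d)`: the image of the Young symmetrizer on `(ℂ^d)^{⊗ n}`. (`U(d)`
acts on it by `u ↦ u^{⊗ n}`, which commutes with the permutations of the tensor factors.) -/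
def weyl {n : ℕ} (d : ℕ) (p : n.Partition) : Submodule ℂ (TensorPow n d) :=
  LinearMap.range ((permRep n d).asAlgebraHom (youngSymmetrizer p))

/-! ### The Weingarten function -/

/-- The Weingarten function
`Wg(σ) = (n!)⁻² ∑_{λ ⊢ n, ℓ(λ) ≤ d} (dim S^λ)² / (dim W^λ) χ^λ(σ)`. -/
def Wg (n d : ℕ) (σ : Equiv.Perm (Fin n)) : ℂ :=
  1 / ((n ! : ℂ) ^ 2) *
    ∑ p : n.Partition with p.parts.card ≤ d,
      ((Module.finrank ℂ (specht p) : ℂ) ^ 2 / (Module.finrank ℂ (weyl d p) : ℂ)) *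
        spechtChar p σ

/-- The place permutation of a multi-index: `σ(i)_k = i_{σ⁻¹(k)}`. -/
def permIndex {n d : ℕ} (σ : Equiv.Perm (Fin n)) (i : Fin n → Fin d) : Fin n → Fin d :=
  fun k => i (σ⁻¹ k)

end

end Weingarten

/-!
The algebraic half of the argument takes place in the group algebra `A = ℂ[S_n]`. By von Neumann's
lemma, Young symmetrizers of different shapes satisfy `c A c' = 0`
(`youngSymmetrizer_mul_mul_eq_zero`), and `c A c = ℂ c` for a single one
(`youngSymmetrizer_mul_mul_self`); both come from counting boxes of Young diagrams. Hence `k⁻¹ c` is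
an idempotent for a scalar `k ≠ 0`, and the Specht module is the left ideal it generates. The trace of left
multiplication on that ideal shows that `∑ χ(σ) σ` is the sum of the conjugates of `k⁻¹ c`, and that
the Specht characters are orthogonal. There are as many of them as conjugacy classes, so they expand
every class function (`sum_mul_charElement`). For the character of `(ℂ^d)^{⊗ n}` the coefficients are
the traces of `k⁻¹ c`, that is, the dimensions of the Weyl modules. Therefore, in the action on
tensors, the element `∑ Wg(σ) σ` is inverse to the Gram element `G = ∑ Tr(σ) σ`
(`permMatrix_wgElement_mul_gramElement`); the shapes with more than `d` rows act by zero.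

The analytic half concerns the matrix `T` of the integrals, indexed by the multi-indices `i` and `i'`.
Invariance of the Haar measure makes `T` commute with `u^{⊗ n}` for unitary `u`; the spectral theorem
and a polynomial identity extend this to `A^{⊗ n}` for every matrix `A` (`commute_tensorMatrix`), and
polarization extends it to the average of any matrix `Y` over `S_n`. The latter reads
`∑ T σ Y σ⁻¹ = ∑ σ Y σ⁻¹ T` for all `Y`. Multiplying the second factor of
`∑ T σ ⊗ σ⁻¹ = ∑ σ ⊗ σ⁻¹ T` by `w = ∑ Wg(σ) σ` and taking its trace turns the left side into
`T w G = T` and the right side into `∑ Tr(w σ⁻¹ T) σ` (`eq_sum_trace_smul_permMatrix`). The trace is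
unchanged when `T` is replaced by its integrand, so it is an entry of the matrix of `w σ⁻¹`
(`trace_permMatrix_mul_moment`).
-/

namespace Weingarten

open Finset

variable {n d : ℕ}

/-- The group elements as elements of the group algebra. -/
local notation "ι" => MonoidAlgebra.of ℂ (Equiv.Perm (Fin n))

/-! ### Counting boxes of Young diagrams -/

/-- The boxes of the diagram are the pairs `(rowOf p k, colOf p k)`. -/
theorem mem_diagram_iff_exists (p : n.Partition) (c : ℕ × ℕ) :
    c ∈ diagram p ↔ ∃ m, rowOf p m = c.1 ∧ colOf p m = c.2 := by
  constructor
  · intro h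
    refine ⟨(tableau p).symm ⟨c, h⟩, ?_⟩
    simp [rowOf, colOf]
  · rintro ⟨m, h1, h2⟩
    have h : (rowOf p m, colOf p m) ∈ diagram p := (tableau p m).2
    rwa [h1, h2] at h

theorem eq_of_rowOf_eq_of_colOf_eq (p : n.Partition) {m m' : Fin n}
    (h1 : rowOf p m = rowOf p m') (h2 : colOf p m = colOf p m') : m = m' :=
  (tableau p).injective (Subtype.ext (Prod.ext h1 h2))

theorem card_rowOf_lt_colOf_eq (p : n.Partition) (k j : ℕ) :
    #{m | rowOf p m < k ∧ colOf p m = j} = min k ((diagram p).colLen j) := by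
  rw [← card_range (min k _)]
  refine card_bij (fun m _ => rowOf p m) ?_ ?_ ?_
  · intro m hm
    simp only [mem_filter, mem_univ, true_and] at hm
    simp only [mem_range, lt_min_iff, ← YoungDiagram.mem_iff_lt_colLen]
    exact ⟨hm.1, (mem_diagram_iff_exists p _).2 ⟨m, rfl, hm.2⟩⟩
  · intro m hm m' hm' h
    simp only [mem_filter, mem_univ, true_and] at hm hm'
    exact eq_of_rowOf_eq_of_colOf_eq p h (hm.2.trans hm'.2.symm)
  · intro i hi
    simp only [mem_range, lt_min_iff, ← YoungDiagram.mem_iff_lt_colLen] at hi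
    obtain ⟨m, h1, h2⟩ := (mem_diagram_iff_exists p _).1 hi.2
    exact ⟨m, by simp_all, h1⟩

theorem card_colOf_eq (p : n.Partition) (j : ℕ) :
    #{m | colOf p m = j} = (diagram p).colLen j := by
  rw [← card_range ((diagram p).colLen j)]
  refine card_bij (fun m _ => rowOf p m) ?_ ?_ ?_
  · intro m hm
    simp only [mem_filter, mem_univ, true_and] at hm
    simp only [mem_range, ← YoungDiagram.mem_iff_lt_colLen]
    exact (mem_diagram_iff_exists p _).2 ⟨m, rfl, hm⟩
  · intro m hm m' hm' h
    simp only [mem_filter, mem_univ, true_and] at hm hm'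
    exact eq_of_rowOf_eq_of_colOf_eq p h (hm.trans hm'.symm)
  · intro i hi
    simp only [mem_range, ← YoungDiagram.mem_iff_lt_colLen] at hi
    obtain ⟨m, h1, h2⟩ := (mem_diagram_iff_exists p _).1 hi
    exact ⟨m, by simp_all, h1⟩

theorem card_rowOf_eq (p : n.Partition) (i : ℕ) :
    #{m | rowOf p m = i} = (diagram p).rowLen i := by
  rw [← card_range ((diagram p).rowLen i)]
  refine card_bij (fun m _ => colOf p m) ?_ ?_ ?_
  · intro m hm
    simp only [mem_filter, mem_univ, true_and] at hm
    simp only [mem_range, ← YoungDiagram.mem_iff_lt_rowLen]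
    exact (mem_diagram_iff_exists p _).2 ⟨m, hm, rfl⟩
  · intro m hm m' hm' h
    simp only [mem_filter, mem_univ, true_and] at hm hm'
    exact eq_of_rowOf_eq_of_colOf_eq p (hm.trans hm'.symm) h
  · intro i hi
    simp only [mem_range, ← YoungDiagram.mem_iff_lt_rowLen] at hi
    obtain ⟨m, h1, h2⟩ := (mem_diagram_iff_exists p _).1 hi
    exact ⟨m, by simp_all, h2⟩

/-- If `f` separates the entries of each column of a tableau, then at most `min k (colLen j)` entries
of the column `j` have an `f`-value below `k`. -/
theorem card_lt_colOf_eq_le (p : n.Partition) (g : Equiv.Perm (Fin n)) (f : Fin n → ℕ)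
    (hf : ∀ m m', f m = f m' → colOf p (g m) = colOf p (g m') → m = m') (k j : ℕ) :
    #{m | f m < k ∧ colOf p (g m) = j} ≤ #{m | rowOf p m < k ∧ colOf p m = j} := by
  rw [card_rowOf_lt_colOf_eq, le_min_iff]
  constructor
  · rw [← card_range k]
    refine card_le_card_of_injOn f (fun m hm => ?_) fun m hm m' hm' h => ?_
    · simp_all
    · simp only [coe_filter, mem_univ, true_and, Set.mem_ofPred_eq] at hm hm'
      exact hf m m' h (hm.2.trans hm'.2.symm)
  · rw [← card_colOf_eq]
    refine card_le_card_of_injOn g (fun m hm => ?_) g.injective.injOn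
    simp_all

theorem card_lt_eq_sum (p : n.Partition) (g : Equiv.Perm (Fin n)) (f : Fin n → ℕ) (k : ℕ) :
    #{m | f m < k} = ∑ j ∈ univ.image (colOf p), #{m | f m < k ∧ colOf p (g m) = j} := by
  rw [card_eq_sum_card_fiberwise (f := fun m => colOf p (g m)) (t := univ.image (colOf p))
    fun m _ => by simp]
  simp only [filter_filter]

/-- Dominance: if entries in the same row of one tableau are never in the same column of another,
the first `k` rows of the former hold at most as many boxes as those of the latter. -/
theorem card_rowOf_lt_le (p : n.Partition) (g : Equiv.Perm (Fin n)) (f : Fin n → ℕ)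
    (hf : ∀ m m', f m = f m' → colOf p (g m) = colOf p (g m') → m = m') (k : ℕ) :
    #{m | f m < k} ≤ #{m | rowOf p m < k} := by
  rw [card_lt_eq_sum p g f k, card_lt_eq_sum p 1 (rowOf p) k]
  exact sum_le_sum fun j _ => card_lt_colOf_eq_le p g f hf k j

/-- A partition is determined by the numbers of boxes in the first `k` rows of its diagram. -/
theorem eq_of_card_rowOf_lt_eq {p q : n.Partition}
    (h : ∀ k, #{m | rowOf p m < k} = #{m | rowOf q m < k}) : p = q := by
  have key : ∀ (r : n.Partition) (k : ℕ),
      #{m | rowOf r m < k + 1} = #{m | rowOf r m < k} + (diagram r).rowLen k := by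
    intro r k
    rw [← card_rowOf_eq, ← card_union_of_disjoint, ← filter_or]
    · congr 1; ext m; simp only [mem_filter, mem_univ, true_and]; omega
    · rw [disjoint_filter]; intro m _ h1 h2; omega
  have hrow : ∀ k, (diagram p).rowLen k = (diagram q).rowLen k := fun k => by
    have h1 := key p k
    have h2 := key q k
    rw [h, h] at h1
    omega
  have hd : diagram p = diagram q := by
    ext ⟨i, j⟩
    rw [YoungDiagram.mem_cells, YoungDiagram.mem_cells, YoungDiagram.mem_iff_lt_rowLen, hrow,
      YoungDiagram.mem_iff_lt_rowLen]
  have hl : ∀ r : n.Partition, (diagram r).rowLens = r.parts.sort (· ≥ ·) := fun r =>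
    YoungDiagram.rowLens_ofRowLens_eq_self fun x hx => r.parts_pos ((Multiset.mem_sort _).1 hx)
  have hs : p.parts.sort (· ≥ ·) = q.parts.sort (· ≥ ·) := by rw [← hl, ← hl, hd]
  refine Nat.Partition.ext ?_
  rw [← Multiset.sort_eq p.parts (· ≥ ·), hs, Multiset.sort_eq]

/-- If entries in the same column of a tableau never land in the same row under `g`, then `g` is the
product of a row permutation and a column permutation: the column permutation moves `m` to the box in
the column of `m` and the row of `g m`, and the counting shows that this box is in the diagram. -/
theorem exists_mul_of_separates (p : n.Partition) (g : Equiv.Perm (Fin n))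
    (hg : ∀ m m', rowOf p (g m) = rowOf p (g m') → colOf p m = colOf p m' → m = m') :
    ∃ r c : Equiv.Perm (Fin n), (∀ m, rowOf p (r m) = rowOf p m) ∧
      (∀ m, colOf p (c m) = colOf p m) ∧ g = r * c := by
  have hle := card_lt_colOf_eq_le p 1 (fun m => rowOf p (g m)) hg
  have hsum : ∀ k, #{m | rowOf p (g m) < k} = #{m | rowOf p m < k} := fun k =>
    card_bij (fun m _ => g m) (fun m hm => by simp_all) (fun m _ m' _ h => g.injective h)
      fun m hm => ⟨g⁻¹ m, by simp_all, by simp⟩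
  have heq : ∀ k, ∀ j ∈ univ.image (colOf p),
      #{m | rowOf p (g m) < k ∧ colOf p m = j} = #{m | rowOf p m < k ∧ colOf p m = j} := by
    intro k
    have h := hsum k
    rw [card_lt_eq_sum p 1 _ k, card_lt_eq_sum p 1 (rowOf p) k] at h
    exact (sum_eq_sum_iff_of_le fun j _ => hle k j).1 h
  have hmem : ∀ m, (rowOf p (g m), colOf p m) ∈ diagram p := by
    intro m
    rw [YoungDiagram.mem_iff_lt_colLen]
    have h := heq ((diagram p).colLen (colOf p m)) (colOf p m) (mem_image_of_mem _ (mem_univ m))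
    rw [card_rowOf_lt_colOf_eq, min_self, ← card_colOf_eq] at h
    have h' := eq_of_subset_of_card_le
      (s := {m' | rowOf p (g m') < #{m' | colOf p m' = colOf p m} ∧ colOf p m' = colOf p m})
      (t := {m' | colOf p m' = colOf p m}) (fun m' hm' => by simp_all) h.ge
    have : m ∈ ({m' | colOf p m' = colOf p m} : Finset (Fin n)) := by simp
    rw [← h', card_colOf_eq] at this
    simpa using this
  choose c hc1 hc2 using fun m => (mem_diagram_iff_exists p _).1 (hmem m)
  simp only at hc1 hc2
  have hinj : Function.Injective c := fun m m' h => by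
    refine hg m m' ?_ ?_
    · rw [← hc1 m, h, hc1]
    · rw [← hc2 m, h, hc2]
  let c' : Equiv.Perm (Fin n) := Equiv.ofBijective c (Finite.injective_iff_bijective.1 hinj)
  have hc' : ∀ m, c' m = c m := fun _ => rfl
  refine ⟨g * c'⁻¹, c', fun m => ?_, fun m => hc2 m, by simp⟩
  have h := hc1 (c'⁻¹ m)
  rw [← hc', show c' (c'⁻¹ m) = m from c'.apply_symm_apply m] at h
  exact h.symm

/-! ### Young symmetrizers -/

/-- The sum over the row stabilizer of the tableau. -/
noncomputable def rowSum (p : n.Partition) : GroupAlg n :=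
  ∑ σ : Equiv.Perm (Fin n) with ∀ k, rowOf p (σ k) = rowOf p k, ι σ

/-- The signed sum over the column stabilizer of the tableau. -/
noncomputable def colSum (p : n.Partition) : GroupAlg n :=
  ∑ σ : Equiv.Perm (Fin n) with ∀ k, colOf p (σ k) = colOf p k,
    ((Equiv.Perm.sign σ : ℤ) : ℂ) • ι σ

theorem youngSymmetrizer_eq (p : n.Partition) : youngSymmetrizer p = rowSum p * colSum p := rfl

theorem symm_fixes {f : Fin n → ℕ} {r : Equiv.Perm (Fin n)} (hr : ∀ k, f (r k) = f k) (k : Fin n) :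
    f (r.symm k) = f k := by
  rw [← hr, r.apply_symm_apply]

theorem of_mul_rowSum (p : n.Partition) {r : Equiv.Perm (Fin n)}
    (hr : ∀ k, rowOf p (r k) = rowOf p k) : ι r * rowSum p = rowSum p := by
  rw [rowSum, mul_sum]
  refine sum_bij' (fun σ _ => r * σ) (fun σ _ => r⁻¹ * σ) ?_ ?_ ?_ ?_ ?_
  · intro σ hσ; simp_all
  · intro σ hσ; have h := symm_fixes hr; simp_all
  · intro σ _; simp
  · intro σ _; simp
  · intro σ _; rw [map_mul]

theorem rowSum_mul_of (p : n.Partition) {r : Equiv.Perm (Fin n)}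
    (hr : ∀ k, rowOf p (r k) = rowOf p k) : rowSum p * ι r = rowSum p := by
  rw [rowSum, sum_mul]
  refine sum_bij' (fun σ _ => σ * r) (fun σ _ => σ * r⁻¹) ?_ ?_ ?_ ?_ ?_
  · intro σ hσ; simp_all
  · intro σ hσ; have h := symm_fixes hr; simp_all
  · intro σ _; simp
  · intro σ _; simp
  · intro σ _; rw [map_mul]

theorem sign_mul_self (c : Equiv.Perm (Fin n)) :
    ((Equiv.Perm.sign c : ℤ) : ℂ) * ((Equiv.Perm.sign c : ℤ) : ℂ) = 1 := by
  rw [← Int.cast_mul, ← Units.val_mul, Int.units_mul_self]; simp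

theorem of_mul_colSum (p : n.Partition) {c : Equiv.Perm (Fin n)}
    (hc : ∀ k, colOf p (c k) = colOf p k) :
    ι c * colSum p = ((Equiv.Perm.sign c : ℤ) : ℂ) • colSum p := by
  rw [colSum, mul_sum, smul_sum]
  refine sum_bij' (fun σ _ => c * σ) (fun σ _ => c⁻¹ * σ) ?_ ?_ ?_ ?_ ?_
  · intro σ hσ; simp_all
  · intro σ hσ; have h := symm_fixes hc; simp_all
  · intro σ _; simp
  · intro σ _; simp
  · intro σ _
    rw [map_mul, map_mul, Units.val_mul, Int.cast_mul, smul_smul, ← mul_assoc, sign_mul_self,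
      one_mul, mul_smul_comm]

theorem colSum_mul_of (p : n.Partition) {c : Equiv.Perm (Fin n)}
    (hc : ∀ k, colOf p (c k) = colOf p k) :
    colSum p * ι c = ((Equiv.Perm.sign c : ℤ) : ℂ) • colSum p := by
  rw [colSum, sum_mul, smul_sum]
  refine sum_bij' (fun σ _ => σ * c) (fun σ _ => σ * c⁻¹) ?_ ?_ ?_ ?_ ?_
  · intro σ hσ; simp_all
  · intro σ hσ; have h := symm_fixes hc; simp_all
  · intro σ _; simp
  · intro σ _; simp
  · intro σ _
    rw [map_mul, map_mul, Units.val_mul, Int.cast_mul, smul_smul, mul_left_comm, sign_mul_self,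
      mul_one, smul_mul_assoc]

theorem swap_fixes {f : Fin n → ℕ} {m m' : Fin n} (h : f m = f m') (k : Fin n) :
    f (Equiv.swap m m' k) = f k := by
  rw [Equiv.swap_apply_def]
  split_ifs with h1 h2 <;> simp_all

theorem eq_zero_of_eq_neg {x : GroupAlg n} (h : x = -x) : x = 0 := by
  have h2 : (2 : ℂ) • x = 0 := by rw [two_smul]; nth_rewrite 2 [h]; exact add_neg_cancel x
  exact (smul_eq_zero.1 h2).resolve_left two_ne_zero

/-- Two numbers in a common row of one tableau and in a common column of another give a
transposition that fixes one factor and changes the sign of the other. -/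
theorem colSum_mul_of_mul_rowSum_eq_zero (p q : n.Partition) (g : Equiv.Perm (Fin n))
    {m m' : Fin n} (hne : m ≠ m') (hr : rowOf q m = rowOf q m')
    (hc : colOf p (g m) = colOf p (g m')) : colSum p * ι g * rowSum q = 0 := by
  refine eq_zero_of_eq_neg ?_
  have h1 : g * Equiv.swap m m' = Equiv.swap (g m) (g m') * g := by
    rw [Equiv.swap_mul_eq_mul_swap]; simp
  have h2 := colSum_mul_of p (swap_fixes hc)
  rw [Equiv.Perm.sign_swap (g.injective.ne hne)] at h2
  nth_rewrite 1 [← of_mul_rowSum q (swap_fixes hr)]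
  rw [← mul_assoc, mul_assoc (colSum p), ← map_mul, h1, map_mul, ← mul_assoc, h2]
  simp

theorem rowSum_mul_of_mul_colSum_eq_zero (p q : n.Partition) (g : Equiv.Perm (Fin n))
    {m m' : Fin n} (hne : m ≠ m') (hr : colOf q m = colOf q m')
    (hc : rowOf p (g m) = rowOf p (g m')) : rowSum p * ι g * colSum q = 0 := by
  refine eq_zero_of_eq_neg ?_
  have h1 : Equiv.swap (g m) (g m') * g = g * Equiv.swap m m' := by
    rw [Equiv.swap_mul_eq_mul_swap]; simp
  have h2 := of_mul_colSum q (swap_fixes hr)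
  rw [Equiv.Perm.sign_swap hne] at h2
  nth_rewrite 1 [← rowSum_mul_of p (swap_fixes hc)]
  rw [mul_assoc (rowSum p), ← map_mul, h1, map_mul, mul_assoc, mul_assoc, h2, ← mul_assoc]
  simp

theorem mul_mul_eq_zero_of_forall_of {a b : GroupAlg n} (h : ∀ g, a * ι g * b = 0)
    (x : GroupAlg n) : a * x * b = 0 := by
  induction x using MonoidAlgebra.induction_on with
  | of g => exact h g
  | add x y hx hy => rw [mul_add, add_mul, hx, hy, add_zero]
  | smul r x hx => rw [mul_smul_comm, smul_mul_assoc, hx, smul_zero]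

/-- Young symmetrizers of different shapes annihilate each other: otherwise each shape would
dominate the other. -/
theorem youngSymmetrizer_mul_mul_eq_zero {p q : n.Partition} (hpq : p ≠ q) (x : GroupAlg n) :
    youngSymmetrizer p * x * youngSymmetrizer q = 0 := by
  simp only [youngSymmetrizer_eq]
  by_cases h1 : ∀ g, colSum p * ι g * rowSum q = 0
  · rw [mul_assoc (rowSum p), mul_assoc, ← mul_assoc (colSum p * x),
      mul_mul_eq_zero_of_forall_of h1, zero_mul, mul_zero]
  by_cases h2 : ∀ g, rowSum p * ι g * colSum q = 0
  · have := mul_mul_eq_zero_of_forall_of h2 (colSum p * x * rowSum q)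
    simpa only [mul_assoc] using this
  exfalso
  push Not at h1 h2
  obtain ⟨g, hg⟩ := h1
  obtain ⟨h, hh⟩ := h2
  refine hpq (eq_of_card_rowOf_lt_eq fun k => le_antisymm ?_ ?_)
  · refine card_rowOf_lt_le q h⁻¹ (rowOf p) (fun m m' e1 e2 => ?_) k
    by_contra hne
    refine hh (rowSum_mul_of_mul_colSum_eq_zero p q h ((h⁻¹).injective.ne hne) e2 ?_)
    simpa using e1
  · refine card_rowOf_lt_le p g (rowOf q) (fun m m' e1 e2 => ?_) k
    by_contra hne
    exact hg (colSum_mul_of_mul_rowSum_eq_zero p q g hne e1 e2)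

/-- The equivariance `r x = x` and `x c = sgn(c) x` of `x` under the row stabilizer on the left and
the column stabilizer on the right. -/
def IsYoungEquivariant (p : n.Partition) (x : GroupAlg n) : Prop :=
  (∀ r, (∀ k, rowOf p (r k) = rowOf p k) → ι r * x = x) ∧
    ∀ c, (∀ k, colOf p (c k) = colOf p k) → x * ι c = ((Equiv.Perm.sign c : ℤ) : ℂ) • x

theorem isYoungEquivariant_mul (p : n.Partition) (x : GroupAlg n) :
    IsYoungEquivariant p (rowSum p * x * colSum p) := by
  refine ⟨fun r hr => ?_, fun c hc => ?_⟩
  · rw [← mul_assoc, ← mul_assoc, of_mul_rowSum p hr]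
  · rw [mul_assoc, colSum_mul_of p hc, mul_smul_comm]

theorem isYoungEquivariant_youngSymmetrizer (p : n.Partition) :
    IsYoungEquivariant p (youngSymmetrizer p) := by
  have h := isYoungEquivariant_mul p 1
  rwa [mul_one] at h

theorem IsYoungEquivariant.coeff_mul_mul {p : n.Partition} {x : GroupAlg n}
    (hx : IsYoungEquivariant p x) {r c : Equiv.Perm (Fin n)} (g : Equiv.Perm (Fin n))
    (hr : ∀ k, rowOf p (r k) = rowOf p k) (hc : ∀ k, colOf p (c k) = colOf p k) :
    x.coeff (r * g * c) = ((Equiv.Perm.sign c : ℤ) : ℂ) * x.coeff g := by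
  have h1 := congrArg (fun y => y.coeff (g * c)) (hx.1 r⁻¹ (symm_fixes hr))
  have h2 := congrArg (fun y => y.coeff g) (hx.2 c⁻¹ (symm_fixes hc))
  simp only [MonoidAlgebra.of_apply, MonoidAlgebra.coeff_single_mul_apply,
    MonoidAlgebra.coeff_mul_single_apply, MonoidAlgebra.coeff_smul_apply, inv_inv, one_mul, mul_one,
    Equiv.Perm.sign_inv, smul_eq_mul] at h1 h2
  rw [mul_assoc, h1, h2]

/-- Up to scalars, the Young symmetrizer is the only equivariant element. -/
theorem IsYoungEquivariant.smul_eq_smul {p : n.Partition} {x y : GroupAlg n}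
    (hx : IsYoungEquivariant p x) (hy : IsYoungEquivariant p y) :
    y.coeff 1 • x = x.coeff 1 • y := by
  ext g
  simp only [MonoidAlgebra.coeff_smul_apply, smul_eq_mul]
  by_cases hg : ∀ m m', rowOf p (g m) = rowOf p (g m') → colOf p m = colOf p m' → m = m'
  · obtain ⟨r, c, hr, hc, rfl⟩ := exists_mul_of_separates p g hg
    have h1 := hx.coeff_mul_mul 1 hr hc
    have h2 := hy.coeff_mul_mul 1 hr hc
    rw [mul_one] at h1 h2
    rw [h1, h2]; ring
  · push Not at hg
    obtain ⟨m, m', hr, hc, hne⟩ := hg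
    -- the transposition of `g m` and `g m'` on the left is that of `m` and `m'` on the right
    have key : ∀ z : GroupAlg n, IsYoungEquivariant p z → z.coeff g = 0 := by
      intro z hz
      have h := hz.coeff_mul_mul g (swap_fixes hr) (swap_fixes hc)
      rw [Equiv.Perm.sign_swap hne, mul_assoc, Equiv.mul_swap_eq_swap_mul,
        Equiv.swap_mul_self_mul] at h
      simp at h
      exact self_eq_neg.1 h
    rw [key x hx, key y hy, mul_zero, mul_zero]

theorem coeff_one_youngSymmetrizer (p : n.Partition) : (youngSymmetrizer p).coeff 1 = 1 := by
  rw [youngSymmetrizer_eq, rowSum, colSum, sum_mul, MonoidAlgebra.coeff_sum, Finsupp.finsetSum_apply]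
  simp only [MonoidAlgebra.of_apply, MonoidAlgebra.coeff_single_mul_apply, one_mul, mul_one,
    MonoidAlgebra.coeff_sum, Finsupp.finsetSum_apply, MonoidAlgebra.coeff_smul_apply,
    MonoidAlgebra.coeff_single, smul_eq_mul]
  rw [sum_eq_single 1]
  · rw [sum_eq_single 1]
    · simp
    · intro c _ hc; simp [hc]
    · simp
  · intro r hr hr1
    refine sum_eq_zero fun c hc => ?_
    simp only [mem_filter, mem_univ, true_and] at hr hc
    rw [Finsupp.single_apply, if_neg, mul_zero]
    rintro rfl
    refine hr1 (Equiv.ext fun m => ?_)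
    exact eq_of_rowOf_eq_of_colOf_eq p (hr m) (by have := hc (r m); simp at this; exact this.symm)
  · simp

/-- The corner of the group algebra cut out by a Young symmetrizer is one-dimensional. -/
theorem youngSymmetrizer_mul_mul_self (p : n.Partition) (x : GroupAlg n) :
    youngSymmetrizer p * x * youngSymmetrizer p =
      (youngSymmetrizer p * x * youngSymmetrizer p).coeff 1 • youngSymmetrizer p := by
  have h : IsYoungEquivariant p (youngSymmetrizer p * x * youngSymmetrizer p) := by
    have := isYoungEquivariant_mul p (colSum p * x * rowSum p)
    simpa only [youngSymmetrizer_eq, mul_assoc] using this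
  have := h.smul_eq_smul (isYoungEquivariant_youngSymmetrizer p)
  rwa [coeff_one_youngSymmetrizer, one_smul] at this

/-! ### Characters of the symmetric group -/

/-- The scalar `k` with `c² = k c` for the Young symmetrizer `c`. -/
noncomputable def youngScalar (p : n.Partition) : ℂ :=
  (youngSymmetrizer p * youngSymmetrizer p).coeff 1

theorem youngSymmetrizer_mul_self (p : n.Partition) :
    youngSymmetrizer p * youngSymmetrizer p = youngScalar p • youngSymmetrizer p := by
  have h := youngSymmetrizer_mul_mul_self p 1
  rwa [mul_one] at h

instance : Module.Finite ℂ (GroupAlg n) :=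
  Module.Finite.of_basis (MonoidAlgebra.basis (Equiv.Perm (Fin n)) ℂ)

theorem trace_mulLeft_mulRight (σ : Equiv.Perm (Fin n)) (b : GroupAlg n) :
    LinearMap.trace ℂ (GroupAlg n) (LinearMap.mulLeft ℂ (ι σ) ∘ₗ LinearMap.mulRight ℂ b) =
      ∑ g, b.coeff (g⁻¹ * σ⁻¹ * g) := by
  rw [LinearMap.trace_eq_matrix_trace ℂ (MonoidAlgebra.basis (Equiv.Perm (Fin n)) ℂ), Matrix.trace]
  refine sum_congr rfl fun g _ => ?_
  rw [Matrix.diag_apply, LinearMap.toMatrix_apply, MonoidAlgebra.basis_apply]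
  change (ι σ * (MonoidAlgebra.single g 1 * b)).coeff g = _
  rw [MonoidAlgebra.of_apply, MonoidAlgebra.coeff_single_mul_apply,
    MonoidAlgebra.coeff_single_mul_apply, one_mul, one_mul, mul_assoc]

/-- The Young symmetrizer is not nilpotent, because right multiplication by it on the group algebra
has trace `n!`. -/
theorem youngScalar_ne_zero (p : n.Partition) : youngScalar p ≠ 0 := by
  intro h
  have h2 := youngSymmetrizer_mul_self p
  rw [h, zero_smul] at h2
  have htr := trace_mulLeft_mulRight 1 (youngSymmetrizer p)
  have hnil : IsNilpotent
      (LinearMap.mulLeft ℂ (ι 1) ∘ₗ LinearMap.mulRight ℂ (youngSymmetrizer p)) := by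
    refine ⟨2, LinearMap.ext fun x => ?_⟩
    simp [pow_two, mul_assoc, h2]
  rw [(LinearMap.isNilpotent_trace_of_isNilpotent hnil).eq_zero] at htr
  simp only [inv_one, mul_one, inv_mul_cancel, coeff_one_youngSymmetrizer, sum_const, card_univ,
    nsmul_eq_mul] at htr
  exact Fintype.card_ne_zero (Nat.cast_eq_zero.1 htr.symm)

/-- The trace of left multiplication on the Specht module, as a functional on the group algebra: the
Specht module is the range of right multiplication by the idempotent `k⁻¹ c`. -/
noncomputable def spechtTrace (p : n.Partition) : GroupAlg n →ₗ[ℂ] ℂ :=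
  LinearMap.trace ℂ (GroupAlg n) ∘ₗ
    LinearMap.lcomp ℂ (GroupAlg n) (LinearMap.mulRight ℂ ((youngScalar p)⁻¹ • youngSymmetrizer p)) ∘ₗ
      LinearMap.mul ℂ (GroupAlg n)

theorem spechtTrace_apply (p : n.Partition) (a : GroupAlg n) :
    spechtTrace p a = LinearMap.trace ℂ (GroupAlg n) (LinearMap.mulLeft ℂ a ∘ₗ
      LinearMap.mulRight ℂ ((youngScalar p)⁻¹ • youngSymmetrizer p)) := rfl

theorem spechtTrace_mul_comm (p : n.Partition) (a b : GroupAlg n) :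
    spechtTrace p (a * b) = spechtTrace p (b * a) := by
  rw [spechtTrace_apply, spechtTrace_apply, LinearMap.mulLeft_mul, LinearMap.comp_assoc,
    LinearMap.trace_comp_comm', LinearMap.mulLeft_mul, LinearMap.comp_assoc, LinearMap.comp_assoc,
    ← Module.End.mul_eq_comp (LinearMap.mulLeft ℂ a), LinearMap.commute_mulLeft_right,
    Module.End.mul_eq_comp]

theorem mul_idempotent_of_mem_specht (p : n.Partition) {x : GroupAlg n} (hx : x ∈ specht p) :
    x * ((youngScalar p)⁻¹ • youngSymmetrizer p) = x := by
  obtain ⟨a, rfl⟩ := Submodule.mem_span_singleton.1 hx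
  rw [smul_eq_mul, mul_smul_comm, mul_assoc, youngSymmetrizer_mul_self, mul_smul_comm, smul_smul,
    inv_mul_cancel₀ (youngScalar_ne_zero p), one_smul]

theorem spechtTrace_of (p : n.Partition) (σ : Equiv.Perm (Fin n)) :
    spechtTrace p (ι σ) = spechtChar p σ := by
  have hmem : ∀ x, (LinearMap.mulLeft ℂ (ι σ) ∘ₗ
      LinearMap.mulRight ℂ ((youngScalar p)⁻¹ • youngSymmetrizer p)) x ∈
        (specht p).restrictScalars ℂ := by
    intro x
    refine Submodule.mem_span_singleton.2 ⟨(youngScalar p)⁻¹ • (ι σ * x), ?_⟩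
    simp [mul_assoc]
  rw [spechtTrace_apply, ← LinearMap.trace_restrict_eq_of_forall_mem _ _ hmem]
  refine congrArg (LinearMap.trace ℂ (specht p)) (LinearMap.ext fun x => Subtype.ext ?_)
  change ι σ * (x.1 * _) = ι σ * x.1
  rw [mul_idempotent_of_mem_specht p x.2]

theorem spechtChar_one (p : n.Partition) : spechtChar p 1 = Module.finrank ℂ (specht p) := by
  have : Module.Finite ℂ (specht p) :=
    inferInstanceAs (Module.Finite ℂ ((specht p).restrictScalars ℂ))
  exact Representation.char_one _

theorem spechtChar_eq_of_isConj (p : n.Partition) {σ τ : Equiv.Perm (Fin n)} (h : IsConj σ τ) :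
    spechtChar p σ = spechtChar p τ := by
  obtain ⟨g, rfl⟩ := isConj_iff.1 h
  rw [← spechtTrace_of, ← spechtTrace_of, map_mul, spechtTrace_mul_comm, ← map_mul,
    inv_mul_cancel_left]

theorem isConj_inv_self (σ : Equiv.Perm (Fin n)) : IsConj σ⁻¹ σ := by
  rw [Equiv.Perm.isConj_iff_cycleType_eq, Equiv.Perm.cycleType_inv]

theorem spechtChar_eq_sum (p : n.Partition) (σ : Equiv.Perm (Fin n)) :
    spechtChar p σ = (youngScalar p)⁻¹ * ∑ g, (youngSymmetrizer p).coeff (g⁻¹ * σ * g) := by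
  rw [← spechtChar_eq_of_isConj p (isConj_inv_self σ), ← spechtTrace_of, spechtTrace_apply,
    trace_mulLeft_mulRight, mul_sum]
  simp

/-- The character as an element `∑ χ(σ) σ` of the group algebra. -/
noncomputable def charElement (p : n.Partition) : GroupAlg n := ∑ σ, spechtChar p σ • ι σ

/-- The character element is the sum of the conjugates of the idempotent `k⁻¹ c`. -/
theorem charElement_eq_sum (p : n.Partition) :
    charElement p = (youngScalar p)⁻¹ • ∑ g, ι g * youngSymmetrizer p * ι g⁻¹ := by
  ext σ
  simp [charElement, MonoidAlgebra.coeff_sum, Finsupp.finsetSum_apply, Finsupp.single_apply,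
    spechtChar_eq_sum, mul_assoc]

theorem map_charElement {ξ : GroupAlg n →ₗ[ℂ] ℂ} (hξ : ∀ a b, ξ (a * b) = ξ (b * a))
    (p : n.Partition) :
    ξ (charElement p) = (n ! : ℂ) * ((youngScalar p)⁻¹ * ξ (youngSymmetrizer p)) := by
  have h : ∀ g, ξ (ι g * youngSymmetrizer p * ι g⁻¹) = ξ (youngSymmetrizer p) := fun g => by
    rw [hξ, ← mul_assoc, ← map_mul, inv_mul_cancel, map_one, one_mul]
  rw [charElement_eq_sum, map_smul, map_sum, sum_congr rfl fun g _ => h g]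
  simp [Fintype.card_perm]
  ring

theorem charElement_mul_charElement {p q : n.Partition} (hpq : p ≠ q) :
    charElement p * charElement q = 0 := by
  rw [charElement_eq_sum, charElement_eq_sum, smul_mul_smul_comm, sum_mul_sum]
  refine smul_eq_zero_of_right _ (sum_eq_zero fun g _ => sum_eq_zero fun h _ => ?_)
  have := youngSymmetrizer_mul_mul_eq_zero hpq (ι g⁻¹ * ι h)
  calc _ = ι g * (youngSymmetrizer p * (ι g⁻¹ * ι h) * youngSymmetrizer q) * ι h⁻¹ := by
        simp only [mul_assoc]
    _ = 0 := by rw [this, mul_zero, zero_mul]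

theorem spechtTrace_charElement (p q : n.Partition) :
    spechtTrace p (charElement q) = ∑ σ, spechtChar p σ * spechtChar q σ := by
  rw [charElement, map_sum]
  refine sum_congr rfl fun σ _ => ?_
  rw [map_smul, spechtTrace_of, smul_eq_mul, mul_comm]

theorem spechtTrace_youngSymmetrizer_self (p : n.Partition) :
    spechtTrace p (youngSymmetrizer p) = youngScalar p := by
  -- `x ↦ c x c` has rank one
  let ξ : GroupAlg n →ₗ[ℂ] ℂ := Finsupp.lapply 1 ∘ₗ
    (MonoidAlgebra.coeffLinearEquiv (M := Equiv.Perm (Fin n)) (S := ℂ) ℂ).toLinearMap ∘ₗ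
      LinearMap.mulLeft ℂ (youngSymmetrizer p) ∘ₗ LinearMap.mulRight ℂ (youngSymmetrizer p)
  have hξ : ∀ x, ξ x = (youngSymmetrizer p * x * youngSymmetrizer p).coeff 1 := fun x => by
    rw [mul_assoc]; rfl
  have h : LinearMap.mulLeft ℂ (youngSymmetrizer p) ∘ₗ
      LinearMap.mulRight ℂ ((youngScalar p)⁻¹ • youngSymmetrizer p) =
        (youngScalar p)⁻¹ • ξ.smulRight (youngSymmetrizer p) := by
    refine LinearMap.ext fun x => ?_
    rw [LinearMap.smul_apply, LinearMap.smulRight_apply, hξ, ← youngSymmetrizer_mul_mul_self]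
    simp [mul_assoc]
  rw [spechtTrace_apply, h, map_smul, LinearMap.trace_smulRight, hξ, youngSymmetrizer_mul_self,
    smul_mul_assoc, MonoidAlgebra.coeff_smul_apply, ← youngScalar, smul_smul,
    inv_mul_cancel₀ (youngScalar_ne_zero p), one_smul]

theorem spechtTrace_youngSymmetrizer_of_ne {p q : n.Partition} (hpq : p ≠ q) :
    spechtTrace p (youngSymmetrizer q) = 0 := by
  rw [spechtTrace_apply, show LinearMap.mulLeft ℂ (youngSymmetrizer q) ∘ₗ
      LinearMap.mulRight ℂ ((youngScalar p)⁻¹ • youngSymmetrizer p) = 0 from ?_, map_zero]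
  refine LinearMap.ext fun x => ?_
  simp [← mul_assoc, youngSymmetrizer_mul_mul_eq_zero hpq.symm]

theorem sum_spechtChar_mul_spechtChar (p q : n.Partition) :
    ∑ σ, spechtChar p σ * spechtChar q σ = if p = q then (n ! : ℂ) else 0 := by
  rw [← spechtTrace_charElement, map_charElement (spechtTrace_mul_comm p)]
  split_ifs with h
  · subst h
    rw [spechtTrace_youngSymmetrizer_self, inv_mul_cancel₀ (youngScalar_ne_zero p), mul_one]
  · rw [spechtTrace_youngSymmetrizer_of_ne h, mul_zero, mul_zero]

/-- Column orthogonality: the character table is square, since conjugacy classes are indexed by cycle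
types, so the orthogonality of its rows implies that of its columns. -/
theorem sum_spechtChar_mul_spechtChar_partition (σ τ : Equiv.Perm (Fin n)) :
    (#{ρ : Equiv.Perm (Fin n) | ρ.partition = σ.partition} : ℂ) *
      ∑ p : n.Partition, spechtChar p σ * spechtChar p τ =
        if σ.partition = τ.partition then (n ! : ℂ) else 0 := by
  classical
  let D : (Fintype.card (Fin n)).Partition → ℂ := fun ν =>
    #{ρ : Equiv.Perm (Fin n) | ρ.partition = ν}
  let K : Matrix n.Partition (Fintype.card (Fin n)).Partition ℂ := fun p ν =>
    if h : ∃ ρ : Equiv.Perm (Fin n), ρ.partition = ν then spechtChar p h.choose else 0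
  have hK : ∀ p (ρ : Equiv.Perm (Fin n)), K p ρ.partition = spechtChar p ρ := by
    intro p ρ
    have h : ∃ ρ' : Equiv.Perm (Fin n), ρ'.partition = ρ.partition := ⟨ρ, rfl⟩
    simp only [K, dif_pos h]
    exact spechtChar_eq_of_isConj p (Equiv.Perm.partition_eq_of_isConj.2 h.choose_spec)
  have h1 : K * Matrix.of (fun ν p => (n ! : ℂ)⁻¹ * (D ν * K p ν)) = 1 := by
    ext p q
    rw [Matrix.mul_apply, Matrix.one_apply]
    have h := sum_spechtChar_mul_spechtChar p q
    rw [← sum_fiberwise univ (fun ρ : Equiv.Perm (Fin n) => ρ.partition)] at h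
    have h' : ∀ ν, ∑ ρ : Equiv.Perm (Fin n) with ρ.partition = ν,
        spechtChar p ρ * spechtChar q ρ = D ν * (K p ν * K q ν) := by
      intro ν
      rw [sum_congr rfl (g := fun _ => K p ν * K q ν), sum_const, nsmul_eq_mul]
      intro ρ hρ
      rw [← (mem_filter.1 hρ).2, hK, hK]
    simp only [h'] at h
    have hn : (n ! : ℂ) ≠ 0 := Nat.cast_ne_zero.2 (Nat.factorial_ne_zero n)
    calc _ = (n ! : ℂ)⁻¹ * ∑ ν, D ν * (K p ν * K q ν) := by
          rw [mul_sum]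
          exact sum_congr rfl fun ν _ => by rw [Matrix.of_apply]; ring
      _ = _ := by rw [h]; split_ifs <;> simp [hn]
  rw [Matrix.mul_eq_one_comm_of_card_eq _ _ _ (by rw [Fintype.card_fin])] at h1
  have h2 := congrFun (congrFun h1 σ.partition) τ.partition
  simp only [Matrix.mul_apply, Matrix.of_apply, hK, Matrix.one_apply] at h2
  have hn : (n ! : ℂ) ≠ 0 := Nat.cast_ne_zero.2 (Nat.factorial_ne_zero n)
  have h3 : (n ! : ℂ)⁻¹ * (D σ.partition * ∑ p : n.Partition, spechtChar p σ * spechtChar p τ) =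
      if σ.partition = τ.partition then 1 else 0 := by
    rw [← h2, mul_sum, mul_sum]
    exact sum_congr rfl fun p _ => by ring
  rw [inv_mul_eq_iff_eq_mul₀ hn] at h3
  rw [show (#{ρ : Equiv.Perm (Fin n) | ρ.partition = σ.partition} : ℂ) = D σ.partition from rfl, h3]
  split_ifs <;> simp

/-- Completeness of the Specht characters: they expand every class function. -/
theorem sum_mul_charElement {ξ : Equiv.Perm (Fin n) → ℂ} (hξ : ∀ σ τ, IsConj σ τ → ξ σ = ξ τ) :
    ∑ p : n.Partition, (∑ τ, ξ τ * spechtChar p τ) • charElement p =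
      (n ! : ℂ) • ∑ σ, ξ σ • ι σ := by
  classical
  have key : ∀ σ, ∑ p : n.Partition, (∑ τ, ξ τ * spechtChar p τ) * spechtChar p σ =
      (n ! : ℂ) * ξ σ := by
    intro σ
    have hD : (#{ρ : Equiv.Perm (Fin n) | ρ.partition = σ.partition} : ℂ) ≠ 0 := by
      rw [Nat.cast_ne_zero]
      exact card_ne_zero_of_mem (mem_filter.2 ⟨mem_univ σ, rfl⟩)
    refine mul_left_cancel₀ hD ?_
    calc _ = ∑ τ, ξ τ * ((#{ρ : Equiv.Perm (Fin n) | ρ.partition = σ.partition} : ℂ) *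
            ∑ p : n.Partition, spechtChar p σ * spechtChar p τ) := by
          simp only [sum_mul, mul_sum]
          rw [sum_comm]
          exact sum_congr rfl fun τ _ => sum_congr rfl fun p _ => by ring
      _ = ∑ τ : Equiv.Perm (Fin n), if τ.partition = σ.partition then ξ σ * (n ! : ℂ) else 0 := by
          refine sum_congr rfl fun τ _ => ?_
          rw [sum_spechtChar_mul_spechtChar_partition]
          by_cases h : τ.partition = σ.partition
          · rw [if_pos h, if_pos h.symm, hξ τ σ (Equiv.Perm.partition_eq_of_isConj.2 h)]
          · rw [if_neg h, if_neg (Ne.symm h), mul_zero]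
      _ = _ := by rw [← sum_filter, sum_const, nsmul_eq_mul]; ring
  simp only [charElement, smul_sum, smul_smul]
  rw [sum_comm]
  exact sum_congr rfl fun σ _ => by rw [← sum_smul, key]

theorem sum_finrank_smul_charElement :
    ∑ p : n.Partition, (Module.finrank ℂ (specht p) : ℂ) • charElement p = (n ! : ℂ) • 1 := by
  have h := sum_mul_charElement (n := n) (ξ := fun σ => if σ = 1 then 1 else 0) fun σ τ h => by
    obtain ⟨g, rfl⟩ := isConj_iff.1 h
    simp
  simpa [spechtChar_one, MonoidAlgebra.one_def] using h

theorem finrank_smul_charElement_mul_self (p : n.Partition) :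
    (Module.finrank ℂ (specht p) : ℂ) • (charElement p * charElement p) =
      (n ! : ℂ) • charElement p := by
  have h := congrArg (charElement p * ·) (sum_finrank_smul_charElement (n := n))
  simp only [mul_sum, mul_smul_comm, mul_one] at h
  rwa [sum_eq_single p (fun q _ hq => by rw [charElement_mul_charElement hq.symm, smul_zero])
    (by simp)] at h

/-! ### The symmetric group acting on tensors -/

/-- The standard basis of `(ℂ^d)^{⊗ n}`, indexed by multi-indices. -/
noncomputable def tensorBasis (n d : ℕ) : Module.Basis (Fin n → Fin d) ℂ (TensorPow n d) :=
  Basis.piTensorProduct fun _ => Pi.basisFun ℂ (Fin d)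

/-- The action of the group algebra on `(ℂ^d)^{⊗ n}`, in matrices indexed by multi-indices. -/
noncomputable def permMatrix (n d : ℕ) :
    GroupAlg n →ₐ[ℂ] Matrix (Fin n → Fin d) (Fin n → Fin d) ℂ :=
  (LinearMap.toMatrixAlgEquiv (tensorBasis n d)).toAlgHom.comp (permRep n d).asAlgebraHom

theorem permMatrix_eq_toMatrix (x : GroupAlg n) : permMatrix n d x =
    LinearMap.toMatrix (tensorBasis n d) (tensorBasis n d) ((permRep n d).asAlgebraHom x) := rfl

theorem permRep_tensorBasis (σ : Equiv.Perm (Fin n)) (a : Fin n → Fin d) :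
    permRep n d σ (tensorBasis n d a) = tensorBasis n d (permIndex σ a) := by
  rw [tensorBasis, Basis.piTensorProduct_apply, Basis.piTensorProduct_apply]
  exact PiTensorProduct.reindex_tprod σ _

theorem permMatrix_of (σ : Equiv.Perm (Fin n)) (a b : Fin n → Fin d) :
    permMatrix n d (ι σ) a b = if a = permIndex σ b then 1 else 0 := by
  rw [permMatrix_eq_toMatrix, LinearMap.toMatrix_apply, Representation.asAlgebraHom_of,
    permRep_tensorBasis, Module.Basis.repr_self, Finsupp.single_apply]
  exact if_congr eq_comm rfl rfl

theorem trace_permMatrix (x : GroupAlg n) : (permMatrix n d x).trace =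
    LinearMap.trace ℂ (TensorPow n d) ((permRep n d).asAlgebraHom x) := by
  rw [permMatrix_eq_toMatrix, ← LinearMap.trace_eq_matrix_trace]

instance : Module.Finite ℂ (TensorPow n d) := Module.Finite.of_basis (tensorBasis n d)

theorem finrank_range_of_mul_self_eq_smul {V : Type*} [AddCommGroup V] [Module ℂ V]
    [Module.Finite ℂ V] {k : ℂ} (hk : k ≠ 0) {f : Module.End ℂ V} (hf : f * f = k • f) :
    (Module.finrank ℂ (LinearMap.range f) : ℂ) = k⁻¹ * LinearMap.trace ℂ V f := by
  have h : LinearMap.IsProj (LinearMap.range f) (k⁻¹ • f) := by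
    refine ⟨fun x => Submodule.smul_mem _ _ (LinearMap.mem_range_self f x), ?_⟩
    rintro _ ⟨x, rfl⟩
    rw [LinearMap.smul_apply, ← Module.End.mul_apply, hf, LinearMap.smul_apply, smul_smul,
      inv_mul_cancel₀ hk, one_smul]
  rw [← h.trace, map_smul, smul_eq_mul]

/-- The dimension of the Weyl module is the trace of the idempotent `k⁻¹ c` on tensors. -/
theorem finrank_weyl (p : n.Partition) : (Module.finrank ℂ (weyl d p) : ℂ) =
    (youngScalar p)⁻¹ * (permMatrix n d (youngSymmetrizer p)).trace := by
  rw [trace_permMatrix]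
  refine finrank_range_of_mul_self_eq_smul (youngScalar_ne_zero p) ?_
  rw [← map_mul, youngSymmetrizer_mul_self, map_smul]

theorem permMatrix_youngSymmetrizer_eq_zero_of_finrank {p : n.Partition}
    (h : Module.finrank ℂ (weyl d p) = 0) : permMatrix n d (youngSymmetrizer p) = 0 := by
  rw [permMatrix_eq_toMatrix, LinearMap.range_eq_bot.1 (Submodule.finrank_eq_zero.1 h), map_zero]

theorem colLen_diagram_zero (p : n.Partition) : (diagram p).colLen 0 = p.parts.card := by
  rw [← YoungDiagram.length_rowLens, diagram, YoungDiagram.rowLens_ofRowLens_eq_self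
    fun x hx => p.parts_pos ((Multiset.mem_sort _).1 hx), Multiset.length_sort]

/-- Antisymmetrizing over more than `d` tensor factors gives zero on `(ℂ^d)^{⊗ n}`. -/
theorem permMatrix_youngSymmetrizer_eq_zero {p : n.Partition} (h : d < p.parts.card) :
    permMatrix n d (youngSymmetrizer p) = 0 := by
  rw [youngSymmetrizer_eq, map_mul]
  suffices h0 : permMatrix n d (colSum p) = 0 by rw [h0, mul_zero]
  ext a b
  have hcard : #(univ : Finset (Fin d)) < #{m | colOf p m = 0} := by
    rw [card_colOf_eq, colLen_diagram_zero]; simpa using h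
  obtain ⟨m, hm, m', hm', hne, hb⟩ :=
    exists_ne_map_eq_of_card_lt_of_maps_to hcard (f := b) fun _ _ => mem_univ _
  have hcol : colOf p m = colOf p m' := by simp_all
  have hperm : permIndex (Equiv.swap m m') b = b := by
    funext k
    rw [permIndex, Equiv.swap_inv, Equiv.swap_apply_def]
    split_ifs with h1 h2 <;> simp_all
  have h1 := congrArg (fun x => permMatrix n d x a b) (colSum_mul_of p (swap_fixes hcol))
  simp only [map_mul, Matrix.mul_apply, permMatrix_of, hperm, mul_ite, mul_one, mul_zero,
    sum_ite_eq', mem_univ, if_true, Equiv.Perm.sign_swap hne, map_smul, Matrix.smul_apply] at h1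
  rw [Matrix.zero_apply]
  simp at h1
  exact self_eq_neg.1 h1

theorem permMatrix_charElement_eq_zero {p : n.Partition}
    (h : permMatrix n d (youngSymmetrizer p) = 0) : permMatrix n d (charElement p) = 0 := by
  simp [charElement_eq_sum, h]

/-- The element `∑ Tr(σ) σ` of the group algebra, for the traces of permutations on tensors. -/
noncomputable def gramElement (n d : ℕ) : GroupAlg n :=
  ∑ σ : Equiv.Perm (Fin n), (permMatrix n d (MonoidAlgebra.of ℂ _ σ)).trace • MonoidAlgebra.of ℂ _ σ

/-- The element `∑ Wg(σ) σ` of the group algebra. -/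
noncomputable def wgElement (n d : ℕ) : GroupAlg n := 
  ∑ σ : Equiv.Perm (Fin n), Wg n d σ • MonoidAlgebra.of ℂ _ σ

theorem factorial_ne_zero_complex (n : ℕ) : (n ! : ℂ) ≠ 0 :=
  Nat.cast_ne_zero.2 (Nat.factorial_ne_zero n)

/-- The character of the tensor power is `∑ dim W^p χ^p`. -/
theorem gramElement_eq_sum :
    gramElement n d = ∑ p : n.Partition, (Module.finrank ℂ (weyl d p) : ℂ) • charElement p := by
  let ξ : GroupAlg n →ₗ[ℂ] ℂ := Matrix.traceLinearMap _ ℂ ℂ ∘ₗ (permMatrix n d).toLinearMap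
  have hξ : ∀ a b, ξ (a * b) = ξ (b * a) := fun a b => by
    change (permMatrix n d (a * b)).trace = (permMatrix n d (b * a)).trace
    rw [map_mul, map_mul, Matrix.trace_mul_comm]
  have h := sum_mul_charElement (n := n) (ξ := fun σ => ξ (ι σ)) fun σ τ hστ => by
    obtain ⟨g, rfl⟩ := isConj_iff.1 hστ
    rw [map_mul ι, hξ, ← map_mul, inv_mul_cancel_left]
  have hp : ∀ p : n.Partition, ∑ τ, ξ (ι τ) * spechtChar p τ =
      (n ! : ℂ) * (Module.finrank ℂ (weyl d p) : ℂ) := by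
    intro p
    rw [finrank_weyl, show (permMatrix n d (youngSymmetrizer p)).trace = ξ (youngSymmetrizer p) from
      rfl, ← map_charElement hξ, charElement, map_sum]
    exact sum_congr rfl fun σ _ => by rw [map_smul, smul_eq_mul, mul_comm]
  simp only [hp, mul_smul, ← smul_sum] at h
  exact (smul_right_injective _ (factorial_ne_zero_complex n) h).symm

theorem wgElement_eq_sum :
    wgElement n d = (1 / ((n ! : ℂ) ^ 2)) • ∑ p : n.Partition with p.parts.card ≤ d,
      ((Module.finrank ℂ (specht p) : ℂ) ^ 2 / (Module.finrank ℂ (weyl d p) : ℂ)) •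
        charElement p := by
  simp only [wgElement, Wg, charElement, smul_sum, mul_smul, sum_smul]
  rw [sum_comm]

/-- On tensors, the Weingarten element is inverse to the Gram element. -/
theorem permMatrix_wgElement_mul_gramElement :
    permMatrix n d (wgElement n d * gramElement n d) = 1 := by
  have hn := factorial_ne_zero_complex n
  have hterm : ∀ p : n.Partition,
      permMatrix n d
        (((Module.finrank ℂ (specht p) : ℂ) ^ 2 / (Module.finrank ℂ (weyl d p) : ℂ)) •
          charElement p * gramElement n d) =
      (n ! : ℂ) • permMatrix n d ((Module.finrank ℂ (specht p) : ℂ) • charElement p) := by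
    intro p
    rw [gramElement_eq_sum, mul_sum, sum_eq_single p (fun q _ hq => by
      rw [smul_mul_smul_comm, charElement_mul_charElement hq.symm, smul_zero]) (by simp)]
    by_cases hm : Module.finrank ℂ (weyl d p) = 0
    · -- both sides vanish, so that the value of the fraction is immaterial
      have := permMatrix_charElement_eq_zero (permMatrix_youngSymmetrizer_eq_zero_of_finrank hm)
      rw [smul_mul_smul_comm, map_smul, map_mul, this, map_smul, this]
      simp
    · rw [smul_mul_smul_comm, div_mul_cancel₀ _ (Nat.cast_ne_zero.2 hm), pow_two, mul_smul,
        finrank_smul_charElement_mul_self, ← map_smul, smul_comm]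
  have hone := congrArg (permMatrix n d) (sum_finrank_smul_charElement (n := n))
  rw [map_smul, map_one, map_sum] at hone
  have hsum : ∑ p : n.Partition with p.parts.card ≤ d,
      permMatrix n d ((Module.finrank ℂ (specht p) : ℂ) • charElement p) = (n ! : ℂ) • 1 := by
    rw [← hone]
    refine sum_filter_of_ne fun p _ hp => ?_
    by_contra hlt
    exact hp (by rw [map_smul, permMatrix_charElement_eq_zero
      (permMatrix_youngSymmetrizer_eq_zero (not_le.1 hlt)), smul_zero])
  rw [wgElement_eq_sum, smul_mul_assoc, sum_mul, map_smul, map_sum,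
    sum_congr rfl fun p _ => hterm p, ← smul_sum, hsum, smul_smul, smul_smul]
  rw [show 1 / (n ! : ℂ) ^ 2 * n ! * n ! = 1 by field_simp, one_smul]

/-! ### The commutant of the unitary group on tensors -/

/-- The `n`-th tensor power of a matrix, in coordinates indexed by multi-indices. -/
def tensorMatrix (n : ℕ) {d : ℕ} (A : Matrix (Fin d) (Fin d) ℂ) :
    Matrix (Fin n → Fin d) (Fin n → Fin d) ℂ :=
  Matrix.of fun a b => ∏ k, A (a k) (b k)

theorem tensorMatrix_apply (A : Matrix (Fin d) (Fin d) ℂ) (a b : Fin n → Fin d) :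
    tensorMatrix n A a b = ∏ k, A (a k) (b k) := rfl

theorem tensorMatrix_mul (A B : Matrix (Fin d) (Fin d) ℂ) :
    tensorMatrix n (A * B) = tensorMatrix n A * tensorMatrix n B := by
  ext a b
  simp only [tensorMatrix_apply, Matrix.mul_apply, prod_univ_sum, Fintype.piFinset_univ,
    prod_mul_distrib]

theorem tensorMatrix_diagonal (z : Fin d → ℂ) :
    tensorMatrix n (Matrix.diagonal z) = Matrix.diagonal fun a => ∏ k, z (a k) := by
  ext a b
  rw [tensorMatrix_apply, Matrix.diagonal_apply]
  split_ifs with h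
  · subst h; simp
  · obtain ⟨k, hk⟩ := Function.ne_iff.1 h
    exact prod_eq_zero (mem_univ k) (by simp [hk])

theorem tensorMatrix_one : tensorMatrix n (1 : Matrix (Fin d) (Fin d) ℂ) = 1 := by
  rw [← Matrix.diagonal_one, tensorMatrix_diagonal]; simp

theorem tensorMatrix_conjTranspose (A : Matrix (Fin d) (Fin d) ℂ) :
    tensorMatrix n A.conjTranspose = (tensorMatrix n A).conjTranspose := by
  ext a b
  simp [tensorMatrix_apply, Matrix.conjTranspose_apply]

theorem eq_permIndex_iff (σ : Equiv.Perm (Fin n)) (a b : Fin n → Fin d) :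
    a = permIndex σ b ↔ permIndex σ⁻¹ a = b := by
  constructor
  · rintro rfl; funext k; simp [permIndex]
  · rintro rfl; funext k; simp [permIndex]

theorem permMatrix_of_mul_apply (σ : Equiv.Perm (Fin n))
    (M : Matrix (Fin n → Fin d) (Fin n → Fin d) ℂ) (a b : Fin n → Fin d) :
    (permMatrix n d (ι σ) * M) a b = M (permIndex σ⁻¹ a) b := by
  simp only [Matrix.mul_apply, permMatrix_of, eq_permIndex_iff]
  simp

theorem mul_permMatrix_of_apply (σ : Equiv.Perm (Fin n))
    (M : Matrix (Fin n → Fin d) (Fin n → Fin d) ℂ) (a b : Fin n → Fin d) :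
    (M * permMatrix n d (ι σ)) a b = M a (permIndex σ b) := by
  simp only [Matrix.mul_apply, permMatrix_of]
  simp

theorem commute_permMatrix_tensorMatrix (x : GroupAlg n) (A : Matrix (Fin d) (Fin d) ℂ) :
    Commute (permMatrix n d x) (tensorMatrix n A) := by
  induction x using MonoidAlgebra.induction_on with
  | of σ =>
    ext a b
    rw [permMatrix_of_mul_apply, mul_permMatrix_of_apply, tensorMatrix_apply, tensorMatrix_apply,
      ← Equiv.prod_comp σ⁻¹]
    simp [permIndex]
  | add x y hx hy => rw [map_add]; exact hx.add_left hy
  | smul r x hx => rw [map_smul]; exact hx.smul_left r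

/-- A matrix that commutes with the tensor powers of the diagonal unitary matrices has non-zero
entries only where row and column index have the same content. -/
theorem commute_tensorMatrix_diagonal {T : Matrix (Fin n → Fin d) (Fin n → Fin d) ℂ}
    (hT : ∀ u : U d, Commute T (tensorMatrix n (u : Matrix (Fin d) (Fin d) ℂ))) (z : Fin d → ℂ) :
    Commute T (tensorMatrix n (Matrix.diagonal z)) := by
  -- a root of unity of order larger than `n` detects multiplicities up to `n`
  let ζ : ℂ := Complex.exp (2 * Real.pi * Complex.I / ((n + 1 : ℕ) : ℂ))
  have hζ : IsPrimitiveRoot ζ (n + 1) := Complex.isPrimitiveRoot_exp (n + 1) n.succ_ne_zero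
  have hζ1 : starRingEnd ℂ ζ * ζ = 1 := by
    rw [mul_comm, Complex.mul_conj, Complex.normSq_eq_norm_sq,
      hζ.norm'_eq_one n.succ_ne_zero]
    simp
  have hprod : ∀ (w : Fin d → ℂ) (a : Fin n → Fin d),
      ∏ k, w (a k) = ∏ l, w l ^ #{k | a k = l} := by
    intro w a
    rw [← prod_fiberwise' univ a w]
    simp [prod_const]
  ext a b
  rw [tensorMatrix_diagonal, Matrix.mul_diagonal, Matrix.diagonal_mul, mul_comm]
  by_cases h0 : T a b = 0
  · rw [h0, mul_zero, mul_zero]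
  congr 1
  rw [hprod, hprod]
  refine prod_congr rfl fun l _ => ?_
  congr 1
  let D : Matrix (Fin d) (Fin d) ℂ := Matrix.diagonal fun l' => if l' = l then ζ else 1
  have hD : star D * D = 1 := by
    rw [Matrix.star_eq_conjTranspose, Matrix.diagonal_conjTranspose, Matrix.diagonal_mul_diagonal,
      ← Matrix.diagonal_one]
    congr 1
    funext l'
    by_cases h : l' = l
    · simpa [h] using hζ1
    · simp [h]
  have h := congrFun (congrFun (hT ⟨D, Matrix.mem_unitaryGroup_iff'.2 hD⟩).eq a) b
  change (T * tensorMatrix n D) a b = (tensorMatrix n D * T) a b at h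
  rw [tensorMatrix_diagonal, Matrix.mul_diagonal, Matrix.diagonal_mul, mul_comm] at h
  have h' := mul_right_cancel₀ h0 h
  have hpow : ∀ c : Fin n → Fin d, (∏ k, if c k = l then ζ else 1) = ζ ^ #{k | c k = l} :=
    fun c => by rw [prod_ite]; simp
  rw [hpow, hpow] at h'
  have hle : ∀ c : Fin n → Fin d, #{k | c k = l} < n + 1 := fun c =>
    Nat.lt_succ_of_le ((card_filter_le _ _).trans (by simp))
  exact hζ.pow_inj (hle b) (hle a) h'

theorem commute_tensorMatrix_of_isHermitian {T : Matrix (Fin n → Fin d) (Fin n → Fin d) ℂ}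
    (hT : ∀ u : U d, Commute T (tensorMatrix n (u : Matrix (Fin d) (Fin d) ℂ)))
    {H : Matrix (Fin d) (Fin d) ℂ} (hH : H.IsHermitian) : Commute T (tensorMatrix n H) := by
  rw [hH.spectral_theorem, Unitary.conjStarAlgAut_apply, tensorMatrix_mul, tensorMatrix_mul]
  exact ((hT _).mul_right (commute_tensorMatrix_diagonal hT _)).mul_right
    (hT (star hH.eigenvectorUnitary))

open Polynomial in
/-- A matrix that commutes with the tensor powers of the unitary matrices commutes with all tensor
powers: `A^{⊗ n}` depends polynomially on the coefficient of the skew-hermitian part of `A`. -/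
theorem commute_tensorMatrix {T : Matrix (Fin n → Fin d) (Fin n → Fin d) ℂ}
    (hT : ∀ u : U d, Commute T (tensorMatrix n (u : Matrix (Fin d) (Fin d) ℂ)))
    (A : Matrix (Fin d) (Fin d) ℂ) : Commute T (tensorMatrix n A) := by
  obtain ⟨H, K, hH, hK, hA⟩ : ∃ H K : Matrix (Fin d) (Fin d) ℂ,
      H.IsHermitian ∧ K.IsHermitian ∧ A = H + Complex.I • K :=
    ⟨realPart A, imaginaryPart A, (realPart A).2, (imaginaryPart A).2,
      (realPart_add_I_smul_imaginaryPart A).symm⟩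
  ext a b
  let Q : (Fin n → Fin d) → (Fin n → Fin d) → ℂ[X] := fun a b =>
    ∏ k, (C (H (a k) (b k)) + X * C (K (a k) (b k)))
  have hQ : ∀ z a b, (Q a b).eval z = tensorMatrix n (H + z • K) a b := fun z a b => by
    simp only [Q, eval_prod, tensorMatrix_apply]
    exact prod_congr rfl fun k _ => by simp [mul_comm z]
  have hl : ∀ z, (∑ c, C (T a c) * Q c b).eval z = (T * tensorMatrix n (H + z • K)) a b :=
    fun z => by simp [eval_finsetSum, hQ, Matrix.mul_apply]
  have hr : ∀ z, (∑ c, Q a c * C (T c b)).eval z = (tensorMatrix n (H + z • K) * T) a b :=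
    fun z => by simp [eval_finsetSum, hQ, Matrix.mul_apply]
  have heq : ∑ c, C (T a c) * Q c b = ∑ c, Q a c * C (T c b) := by
    refine eq_of_infinite_eval_eq _ _
      (Set.Infinite.mono ?_ (Set.infinite_range_of_injective Complex.ofReal_injective))
    rintro _ ⟨r, rfl⟩
    have hherm : (H + (r : ℂ) • K).IsHermitian := by
      refine hH.add ?_
      rw [Matrix.IsHermitian, Matrix.conjTranspose_smul, hK.eq]
      simp
    change eval _ _ = eval _ _
    rw [hl, hr, (commute_tensorMatrix_of_isHermitian hT hherm).eq]
  rw [hA, ← hl, ← hr, heq]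

/-- Polarization: the permanent as an alternating sum of products of sums over subsets. -/
theorem sum_powerset_neg_one_pow_mul_prod_sum (y : Fin n → Fin n → ℂ) :
    ∑ K : Finset (Fin n), (-1 : ℂ) ^ #K * ∏ k, ∑ j ∈ Kᶜ, y k j =
      ∑ σ : Equiv.Perm (Fin n), ∏ k, y k (σ k) := by
  classical
  have h1 : ∀ K : Finset (Fin n), (-1 : ℂ) ^ #K * ∏ k, ∑ j ∈ Kᶜ, y k j =
      ∑ f : Fin n → Fin n, if K ⊆ (univ.image f)ᶜ then (-1 : ℂ) ^ #K * ∏ k, y k (f k) else 0 := by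
    intro K
    rw [prod_univ_sum, ← sum_filter, mul_sum]
    refine sum_congr ?_ fun _ _ => rfl
    ext f
    simp only [Fintype.mem_piFinset, mem_compl, mem_filter, mem_univ, true_and]
    constructor
    · intro h k hk
      simp only [mem_compl, mem_image, mem_univ, true_and, not_exists]
      rintro k' rfl
      exact h k' hk
    · intro h k hk
      have := h hk
      simp at this
  have h2 : ∀ f : Fin n → Fin n,
      (∑ K : Finset (Fin n), if K ⊆ (univ.image f)ᶜ then (-1 : ℂ) ^ #K * ∏ k, y k (f k) else 0) =
        if Function.Bijective f then ∏ k, y k (f k) else 0 := by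
    intro f
    have hbij : (univ.image f)ᶜ = ∅ ↔ Function.Bijective f := by
      rw [compl_eq_empty_iff, ← Finite.surjective_iff_bijective, eq_univ_iff_forall]
      simp [Function.Surjective]
    have h := congrArg (Int.cast : ℤ → ℂ) (sum_powerset_neg_one_pow_card (x := (univ.image f)ᶜ))
    push_cast at h
    rw [← sum_filter, ← sum_mul, show ({K | K ⊆ (univ.image f)ᶜ} : Finset (Finset (Fin n))) =
      ((univ.image f)ᶜ).powerset by ext; simp, h]
    by_cases hf : Function.Bijective f
    · rw [if_pos hf, if_pos (hbij.2 hf), one_mul]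
    · rw [if_neg hf, if_neg (fun h => hf (hbij.1 h)), zero_mul]
  simp only [h1]
  rw [sum_comm]
  simp only [h2]
  rw [← sum_filter]
  refine sum_bij' (fun f hf => Equiv.ofBijective f (mem_filter.1 hf).2) (fun σ _ => ⇑σ) ?_ ?_ ?_ ?_ ?_
  · simp
  · intro σ _; exact mem_filter.2 ⟨mem_univ _, σ.bijective⟩
  · intro f _; rfl
  · intro σ _; ext; rfl
  · intro f _; rfl

/-- A matrix that commutes with all tensor powers commutes with the average of any matrix over the
symmetric group; it is enough to check matrix units, which polarize tensor powers. -/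
theorem sum_permIndex_eq {T : Matrix (Fin n → Fin d) (Fin n → Fin d) ℂ}
    (hT : ∀ A : Matrix (Fin d) (Fin d) ℂ, Commute T (tensorMatrix n A)) (p q a b : Fin n → Fin d) :
    ∑ σ : Equiv.Perm (Fin n), (if b = permIndex σ q then T a (permIndex σ p) else 0) =
      ∑ σ : Equiv.Perm (Fin n), if a = permIndex σ p then T (permIndex σ q) b else 0 := by
  let S : Matrix (Fin n → Fin d) (Fin n → Fin d) ℂ := ∑ K : Finset (Fin n),
    (-1 : ℂ) ^ #K • tensorMatrix n (∑ j ∈ Kᶜ, Matrix.single (p j) (q j) 1)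
  have hS : ∀ x y, S x y = ∑ σ : Equiv.Perm (Fin n),
      if x = permIndex σ p ∧ y = permIndex σ q then 1 else 0 := by
    intro x y
    have h := sum_powerset_neg_one_pow_mul_prod_sum
      fun k j => Matrix.single (p j) (q j) (1 : ℂ) (x k) (y k)
    simp only [S, Matrix.sum_apply, Matrix.smul_apply, tensorMatrix_apply, smul_eq_mul]
    rw [h, ← Equiv.sum_comp (Equiv.inv _)]
    refine sum_congr rfl fun σ _ => ?_
    simp only [Matrix.single_apply, Fintype.prod_ite_zero, prod_const_one, Equiv.inv_apply]
    refine if_congr ?_ rfl rfl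
    rw [funext_iff, funext_iff, ← forall_and]
    exact forall_congr' fun k => and_congr eq_comm eq_comm
  have hcomm : Commute T S :=
    Commute.sum_right _ _ _ fun K _ => (hT _).smul_right _
  have hl : (T * S) a b =
      ∑ σ : Equiv.Perm (Fin n), if b = permIndex σ q then T a (permIndex σ p) else 0 := by
    simp only [Matrix.mul_apply, hS, mul_sum]
    rw [sum_comm]
    refine sum_congr rfl fun σ _ => ?_
    by_cases h : b = permIndex σ q <;> simp [h]
  have hr : (S * T) a b =
      ∑ σ : Equiv.Perm (Fin n), if a = permIndex σ p then T (permIndex σ q) b else 0 := by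
    simp only [Matrix.mul_apply, hS, sum_mul]
    rw [sum_comm]
    refine sum_congr rfl fun σ _ => ?_
    by_cases h : a = permIndex σ p <;> simp [h]
  rw [← hl, ← hr, hcomm.eq]

/-! ### Schur–Weyl duality -/

theorem sum_trace_smul_of_eq_mul_gramElement (w : GroupAlg n) :
    ∑ σ, (permMatrix n d (ι σ⁻¹ * w)).trace • ι σ = w * gramElement n d := by
  induction w using MonoidAlgebra.induction_on with
  | of τ =>
    rw [gramElement, mul_sum, ← Equiv.sum_comp (Equiv.mulLeft τ)]
    refine sum_congr rfl fun σ _ => ?_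
    rw [Equiv.coe_mulLeft, mul_smul_comm, ← map_mul, ← map_mul, mul_inv_rev, inv_mul_cancel_right]
    congr 1
    obtain ⟨g, hg⟩ := isConj_iff.1 (isConj_inv_self σ).symm
    rw [← hg, map_mul, map_mul, map_mul, Matrix.trace_mul_comm, ← map_mul, ← map_mul, ← map_mul,
      inv_mul_cancel_left]
  | add x y hx hy =>
    simp only [mul_add, map_add, Matrix.trace_add, add_smul, sum_add_distrib, hx, hy, add_mul]
  | smul r x hx =>
    simp only [mul_smul_comm, map_smul, Matrix.trace_smul, smul_assoc, ← smul_sum, hx,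
      smul_mul_assoc]

/-- Schur–Weyl duality with coefficients. Commutation of `T` with the averages of matrix units says
`∑ T σ ⊗ σ⁻¹ = ∑ σ ⊗ σ⁻¹ T`; multiplying the second factor by the Weingarten element and taking its
trace gives the claim, because the Weingarten element inverts the Gram element. -/
theorem eq_sum_trace_smul_permMatrix {T : Matrix (Fin n → Fin d) (Fin n → Fin d) ℂ}
    (hT : ∀ u : U d, Commute T (tensorMatrix n (u : Matrix (Fin d) (Fin d) ℂ))) :
    T = ∑ σ, (permMatrix n d (wgElement n d * ι σ⁻¹) * T).trace • permMatrix n d (ι σ) := by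
  have h1 : T * permMatrix n d (wgElement n d * gramElement n d) =
      ∑ σ, (permMatrix n d (ι σ⁻¹) * permMatrix n d (wgElement n d)).trace •
        (T * permMatrix n d (ι σ)) := by
    rw [← sum_trace_smul_of_eq_mul_gramElement, map_sum, mul_sum]
    exact sum_congr rfl fun σ _ => by rw [map_smul, mul_smul_comm, map_mul]
  rw [permMatrix_wgElement_mul_gramElement, mul_one] at h1
  have h2 : ∀ σ, (permMatrix n d (wgElement n d * ι σ⁻¹) * T).trace =
      (permMatrix n d (ι σ⁻¹) * (T * permMatrix n d (wgElement n d))).trace := fun σ => by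
    rw [map_mul, mul_assoc, Matrix.trace_mul_comm, mul_assoc]
  simp only [h2]
  nth_rewrite 1 [h1]
  ext a p
  have key := fun q b => sum_permIndex_eq (commute_tensorMatrix hT) p q a b
  simp only [Matrix.sum_apply, Matrix.smul_apply, smul_eq_mul, mul_permMatrix_of_apply,
    permMatrix_of, Matrix.trace, Matrix.diag_apply, permMatrix_of_mul_apply, inv_inv, sum_mul]
  generalize permMatrix n d (wgElement n d) = W
  calc _ = ∑ q, ∑ b, W b q * ∑ σ : Equiv.Perm (Fin n),
          (if b = permIndex σ q then T a (permIndex σ p) else 0) := by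
        simp only [mul_sum]
        rw [sum_comm]
        refine sum_congr rfl fun q _ => ?_
        rw [sum_comm]
        exact sum_congr rfl fun σ _ => by simp
    _ = ∑ q, ∑ b, W b q * ∑ σ : Equiv.Perm (Fin n),
          (if a = permIndex σ p then T (permIndex σ q) b else 0) := by
        simp only [key]
    _ = _ := by
        simp only [mul_sum]
        rw [sum_comm (s := univ) (t := univ) (γ := Equiv.Perm (Fin n))]
        refine sum_congr rfl fun q _ => ?_
        rw [sum_comm]
        refine sum_congr rfl fun σ _ => ?_
        rw [Matrix.mul_apply, sum_mul]
        refine sum_congr rfl fun b _ => ?_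
        split_ifs <;> ring

/-! ### Moments of Haar unitary matrices -/

instance : Measure.IsHaarMeasure (haar d) :=
  inferInstanceAs (Measure.IsHaarMeasure (Measure.haarMeasure ⊤))

instance : IsProbabilityMeasure (haar d) := ⟨by
  have h := Measure.haarMeasure_self (K₀ := (⊤ : TopologicalSpace.PositiveCompacts (U d)))
  rwa [TopologicalSpace.PositiveCompacts.coe_top] at h⟩

/-- The product `u_{a₁j₁} ⋯ u_{aₙjₙ} ū_{b₁j'₁} ⋯ ū_{bₙj'ₙ}`, as a matrix in `(a, b)`: this is
`u^{⊗ n} E (u^{⊗ n})ᴴ` for the matrix unit `E` at `(j, j')`. -/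
def entryProduct (j j' : Fin n → Fin d) (u : U d) :
    Matrix (Fin n → Fin d) (Fin n → Fin d) ℂ :=
  Matrix.of fun a b =>
    tensorMatrix n (u : Matrix (Fin d) (Fin d) ℂ) a j *
      starRingEnd ℂ (tensorMatrix n (u : Matrix (Fin d) (Fin d) ℂ) b j')

theorem continuous_entryProduct (j j' a b : Fin n → Fin d) :
    Continuous fun u => entryProduct j j' u a b := by
  have h : ∀ k l : Fin d, Continuous fun u : U d => (u : Matrix (Fin d) (Fin d) ℂ) k l :=
    fun k l => continuous_subtype_val.matrix_elem k l
  simp only [entryProduct, Matrix.of_apply, tensorMatrix_apply]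
  exact (continuous_finsetProd _ fun k _ => h _ _).mul
    (Complex.continuous_conj.comp (continuous_finsetProd _ fun k _ => h _ _))

theorem integrable_entryProduct (j j' a b : Fin n → Fin d) :
    Integrable (fun u => entryProduct j j' u a b) (haar d) :=
  (continuous_entryProduct j j' a b).integrable_of_hasCompactSupport
    (HasCompactSupport.of_compactSpace _)

theorem entryProduct_mul (j j' : Fin n → Fin d) (v u : U d) :
    entryProduct j j' (v * u) = tensorMatrix n (v : Matrix (Fin d) (Fin d) ℂ) *
      entryProduct j j' u * (tensorMatrix n (v : Matrix (Fin d) (Fin d) ℂ)).conjTranspose := by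
  ext a b
  simp only [entryProduct, Matrix.of_apply, Matrix.mul_apply, Matrix.conjTranspose_apply,
    Submonoid.coe_mul, tensorMatrix_mul, map_sum, map_mul, sum_mul, mul_sum, starRingEnd_apply]
  exact sum_congr rfl fun x _ => sum_congr rfl fun y _ => by ring

theorem tensorMatrix_conjTranspose_mul_self (v : U d) :
    (tensorMatrix n (v : Matrix (Fin d) (Fin d) ℂ)).conjTranspose *
      tensorMatrix n (v : Matrix (Fin d) (Fin d) ℂ) = 1 := by
  rw [← tensorMatrix_conjTranspose, ← tensorMatrix_mul, ← Matrix.star_eq_conjTranspose,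
    Matrix.mem_unitaryGroup_iff'.1 v.2, tensorMatrix_one]

/-- The matrix of the integrals of `entryProduct`. -/
noncomputable def moment (j j' : Fin n → Fin d) :
    Matrix (Fin n → Fin d) (Fin n → Fin d) ℂ :=
  Matrix.of fun a b => ∫ u, entryProduct j j' u a b ∂(haar d)

theorem mul_moment_mul (j j' : Fin n → Fin d) (M N : Matrix (Fin n → Fin d) (Fin n → Fin d) ℂ)
    (a b : Fin n → Fin d) : (M * moment j j' * N) a b =
      ∫ u, (M * entryProduct j j' u * N) a b ∂(haar d) := by
  simp only [Matrix.mul_apply, moment, Matrix.of_apply, sum_mul]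
  have hint : ∀ x y, Integrable (fun u => M a y * entryProduct j j' u y x * N x b) (haar d) :=
    fun x y => ((integrable_entryProduct j j' y x).const_mul _).mul_const _
  rw [integral_finsetSum _ fun x _ => integrable_finsetSum _ fun y _ => hint x y]
  refine sum_congr rfl fun x _ => ?_
  rw [integral_finsetSum _ fun y _ => hint x y]
  exact sum_congr rfl fun y _ => by rw [integral_mul_const, integral_const_mul]

theorem commute_moment (j j' : Fin n → Fin d) (v : U d) :
    Commute (moment j j') (tensorMatrix n (v : Matrix (Fin d) (Fin d) ℂ)) := by
  have h : tensorMatrix n (v : Matrix (Fin d) (Fin d) ℂ) * moment j j' *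
      (tensorMatrix n (v : Matrix (Fin d) (Fin d) ℂ)).conjTranspose = moment j j' := by
    ext a b
    rw [mul_moment_mul]
    simp only [← entryProduct_mul]
    exact integral_mul_left_eq_self (fun u => entryProduct j j' u a b) v
  change moment j j' * _ = _
  nth_rewrite 1 [← h]
  rw [mul_assoc, tensorMatrix_conjTranspose_mul_self, mul_one]

/-- The trace against a matrix that commutes with `u^{⊗ n}` does not see the averaging over `U(d)`. -/
theorem trace_permMatrix_mul_moment (x : GroupAlg n) (j j' : Fin n → Fin d) :
    (permMatrix n d x * moment j j').trace = permMatrix n d x j' j := by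
  have hu : ∀ u : U d, (permMatrix n d x * entryProduct j j' u).trace = permMatrix n d x j' j := by
    intro u
    have h : permMatrix n d x = (tensorMatrix n (u : Matrix (Fin d) (Fin d) ℂ)).conjTranspose *
        (permMatrix n d x * tensorMatrix n (u : Matrix (Fin d) (Fin d) ℂ)) := by
      rw [(commute_permMatrix_tensorMatrix x _).eq, ← mul_assoc,
        tensorMatrix_conjTranspose_mul_self, one_mul]
    nth_rewrite 2 [h]
    simp only [Matrix.trace, Matrix.diag_apply, Matrix.mul_apply, entryProduct, Matrix.of_apply,
      Matrix.conjTranspose_apply, mul_sum, starRingEnd_apply]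
    exact sum_congr rfl fun a _ => sum_congr rfl fun b _ => by ring
  have h : ∀ a, (permMatrix n d x * moment j j') a a =
      ∫ u, (permMatrix n d x * entryProduct j j' u) a a ∂(haar d) := fun a => by
    simpa only [mul_one] using mul_moment_mul j j' (permMatrix n d x) 1 a a
  have hint : ∀ a, Integrable (fun u => (permMatrix n d x * entryProduct j j' u) a a) (haar d) :=
    fun a => by
      simp only [Matrix.mul_apply]
      exact integrable_finsetSum _ fun b _ => (integrable_entryProduct j j' b a).const_mul _
  calc (permMatrix n d x * moment j j').trace
      = ∫ u, (permMatrix n d x * entryProduct j j' u).trace ∂(haar d) := by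
        simp only [Matrix.trace, Matrix.diag_apply, h]
        rw [integral_finsetSum _ fun a _ => hint a]
    _ = permMatrix n d x j' j := by simp only [hu, integral_const]; simp

theorem moment_apply_eq_sum (i j i' j' : Fin n → Fin d) :
    moment j j' i i' = ∑ σ : Equiv.Perm (Fin n), ∑ τ : Equiv.Perm (Fin n),
      (if permIndex σ i = i' then (1 : ℂ) else 0) * (if permIndex τ j = j' then (1 : ℂ) else 0) *
        Wg n d (τ * σ⁻¹) := by
  rw [eq_sum_trace_smul_permMatrix (commute_moment j j')]
  simp only [trace_permMatrix_mul_moment, Matrix.sum_apply, Matrix.smul_apply, smul_eq_mul]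
  rw [← Equiv.sum_comp (Equiv.inv _)]
  refine sum_congr rfl fun σ _ => ?_
  rw [Equiv.inv_apply, inv_inv, permMatrix_of, if_congr (eq_permIndex_iff _ _ _) rfl rfl, inv_inv,
    wgElement, sum_mul, map_sum, Matrix.sum_apply, sum_mul,
    ← Equiv.sum_comp (Equiv.mulRight σ⁻¹)]
  refine sum_congr rfl fun τ _ => ?_
  rw [Equiv.coe_mulRight, smul_mul_assoc, ← map_mul, inv_mul_cancel_right, map_smul,
    Matrix.smul_apply, permMatrix_of, if_congr eq_comm rfl rfl, smul_eq_mul]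
  ring

end Weingarten

theorem mainTheorem2 (n d : ℕ) (i j i' j' : Fin n → Fin d) :
    ∫ u : Weingarten.U d,
        (∏ k, (u : Matrix (Fin d) (Fin d) ℂ) (i k) (j k)) *
          (∏ k, starRingEnd ℂ ((u : Matrix (Fin d) (Fin d) ℂ) (i' k) (j' k)))
        ∂(Weingarten.haar d) =
      ∑ σ : Equiv.Perm (Fin n), ∑ τ : Equiv.Perm (Fin n),
        (if Weingarten.permIndex σ i = i' then (1 : ℂ) else 0) *
          (if Weingarten.permIndex τ j = j' then (1 : ℂ) else 0) *
            Weingarten.Wg n d (τ * σ⁻¹) := by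
  rw [← Weingarten.moment_apply_eq_sum]
  simp only [← map_prod]
  rfl
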